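/- For a finite abelian group $G$ (written additively), let $\mathsf{D}(G)$ denote its Davenport constant, i.e. the smallest integer $t \geq 1$ such that every finite sequence over $G$ (repetition allowed) of length at least $t$ contains a non-empty subsequence whose terms sum to $0$. Let $C_n$ be the cyclic group of order $n$ and let $\exp(L)$ be the exponent of a finite abelian group $L$. Then for every finite abelian group $L$ and every integer $r \geq 1$, $$\mathsf{D}(L \oplus C_n^r) \sim rn \qquad \text{as } n \to +\infty \text{ with } \exp(L) \mid n,$$ that is, $\mathsf{D}(L \oplus C_n^r)/(rn) \to 1$ as $n$ tends to infinity through the multiples of $\exp(L)$. -/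

import Mathlib

open Filter Asymptotics

/-- The Davenport constant of a finite abelian group `G` (written additively): the smallest
integer `t ≥ 1` such that every sequence over `G` of length at least `t` contains a non-empty
zero-sum subsequence. Sequences are unordered with repetition allowed, i.e. multisets, and
subsequences are submultisets. -/
noncomputable def davenport (G : Type*) [AddCommGroup G] : ℕ :=
  sInf {t : ℕ | 1 ≤ t ∧
    ∀ S : Multiset G, t ≤ Multiset.card S → ∃ T : Multiset G, T ≤ S ∧ T ≠ 0 ∧ T.sum = 0}

/-! The lower bound comes from `n - 1` copies of each standard basis vector. For the upper bound
write `n = q * m` with `q = p ^ k` the largest prime power dividing `n`; it tends to infinity with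
`n`. Lift the terms to integer vectors over a fixed set of generators and extract disjoint blocks of
length `m` whose sums are divisible by `m`. The block sums lie in a `p`-group, where Olson's
group-algebra argument (`exists_zero_sum_of_mem_closure`) finds a zero sum among `r * q + O(1)` of
them, which uses `r * n + O(m)` terms (`exists_zero_sum_of_hasDivisibleBlocks`).

The terms left over once no further block is guaranteed must number `o(n)`. Blocks are built one
prime `s ∣ m` at a time, so it suffices that `s * (ε * s + C)` vectors modulo `s` contain `s` with
sum zero (`exists_hasDivisibleBlocks_prime`). Pigeonhole settles bounded `s`; for large `s` a weak
Alon–Dubiner theorem needs only `s` times a power of `log s`. Either many vectors share a fibre of a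
nontrivial character, and the dimension drops, or Fourier analysis makes the set of subsums grow
geometrically past half the group. -/

/-! ### Expansion of sets under translation, via characters -/

section Fourier

variable {V : Type*} [AddCommGroup V] [DecidableEq V]

/-- The number of elements of `Y` that leave `Y` when translated by `a`. -/
def shiftBoundary (Y : Finset V) (a : V) : ℕ := (Y.filter fun y => y + a ∉ Y).card

theorem shiftBoundary_add_le (Y : Finset V) (a b : V) :
    shiftBoundary Y (a + b) ≤ shiftBoundary Y a + shiftBoundary Y b := by
  have h : Y.filter (fun y => y + (a + b) ∉ Y) ⊆
      Y.filter (fun y => y + a ∉ Y) ∪ (Y.filter (fun y => y + b ∉ Y)).image (fun y => y - a) := by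
    intro y hy
    simp only [Finset.mem_filter, Finset.mem_union, Finset.mem_image] at hy ⊢
    by_cases h1 : y + a ∈ Y
    · exact Or.inr ⟨y + a, ⟨h1, by rw [add_assoc]; exact hy.2⟩, by abel⟩
    · exact Or.inl ⟨hy.1, h1⟩
  exact (Finset.card_le_card h).trans ((Finset.card_union_le _ _).trans
    (Nat.add_le_add_left Finset.card_image_le _))

theorem shiftBoundary_nsmul_le (Y : Finset V) (a : V) (j : ℕ) :
    shiftBoundary Y (j • a) ≤ j * shiftBoundary Y a := by
  induction j with
  | zero => simp [shiftBoundary]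
  | succ j ih =>
    rw [succ_nsmul, Nat.succ_mul]
    exact (shiftBoundary_add_le _ _ _).trans (Nat.add_le_add_right ih _)

theorem card_filter_mem_add_shiftBoundary (Y : Finset V) (a : V) :
    (Y.filter fun y => y + a ∈ Y).card + shiftBoundary Y a = Y.card :=
  Finset.card_filter_add_card_filter_not _

variable [Fintype V]

/-- Expand the square; orthogonality of characters leaves the pairs in `Y` with `y + a = z`. -/
theorem sum_addChar_normSq_mul_re (Y : Finset V) (a : V) :
    ∑ ψ : AddChar V ℂ, ‖∑ y ∈ Y, ψ y‖ ^ 2 * (ψ a).re =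
      Fintype.card V * ((Y.filter fun y => y + a ∈ Y).card : ℝ) := by
  have key : ∑ ψ : AddChar V ℂ, ((‖∑ y ∈ Y, ψ y‖ ^ 2 : ℝ) : ℂ) * ψ a =
      Fintype.card V * ((Y.filter fun y => y + a ∈ Y).card : ℂ) := by
    have h1 : ∀ ψ : AddChar V ℂ, ((‖∑ y ∈ Y, ψ y‖ ^ 2 : ℝ) : ℂ) * ψ a =
        ∑ y ∈ Y, ∑ z ∈ Y, ψ (y + a - z) := by
      intro ψ
      rw [Complex.ofReal_pow, ← Complex.mul_conj', map_sum, Finset.sum_mul_sum, Finset.sum_mul]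
      refine Finset.sum_congr rfl fun y _ => ?_
      rw [Finset.sum_mul]
      refine Finset.sum_congr rfl fun z _ => ?_
      rw [sub_eq_add_neg, AddChar.map_add_eq_mul, AddChar.map_add_eq_mul, AddChar.map_neg_eq_conj]
      ring
    simp_rw [h1]
    rw [Finset.sum_comm]
    simp_rw [Finset.sum_comm (s := (Finset.univ : Finset (AddChar V ℂ))) (t := Y),
      AddChar.sum_apply_eq_ite, sub_eq_zero]
    rw [Finset.card_filter, Nat.cast_sum, Finset.mul_sum]
    refine Finset.sum_congr rfl fun y _ => ?_
    rw [Finset.sum_ite_eq]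
    split_ifs <;> simp
  have := congrArg Complex.re key
  rw [Complex.re_sum] at this
  simp_rw [Complex.re_ofReal_mul] at this
  rw [this]
  norm_cast

/-- On the Fourier side the trivial character contributes a share `|Y| / |V| ≤ 1/2`, and the others
are damped by `1/2`. So on weighted average at most `3/4` of `Y` stays in `Y`. -/
theorem le_sum_shiftBoundary_of_re_le {ι : Type*} (s : Finset ι) (w : ι → ℝ) (x : ι → V)
    (hw : ∀ i ∈ s, 0 ≤ w i)
    (hψ : ∀ ψ : AddChar V ℂ, ψ ≠ 1 → ∑ i ∈ s, w i * (ψ (x i)).re ≤ (∑ i ∈ s, w i) / 2)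
    (Y : Finset V) (hY : 2 * Y.card ≤ Fintype.card V) :
    (∑ i ∈ s, w i) * Y.card ≤ 4 * ∑ i ∈ s, w i * shiftBoundary Y (x i) := by
  classical
  set W := ∑ i ∈ s, w i with hW
  have hW0 : 0 ≤ W := Finset.sum_nonneg hw
  have hV : (0 : ℝ) < Fintype.card V := by
    exact_mod_cast Fintype.card_pos_iff.mpr ⟨(0 : V)⟩
  have e1 : (Fintype.card V : ℝ) * ∑ i ∈ s, w i * ((Y.filter fun y => y + x i ∈ Y).card : ℝ) =
      ∑ ψ : AddChar V ℂ, ‖∑ y ∈ Y, ψ y‖ ^ 2 * ∑ i ∈ s, w i * (ψ (x i)).re := by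
    simp_rw [Finset.mul_sum]
    rw [Finset.sum_comm]
    refine Finset.sum_congr rfl fun i _ => ?_
    rw [mul_left_comm, ← sum_addChar_normSq_mul_re, Finset.mul_sum]
    exact Finset.sum_congr rfl fun ψ _ => by ring
  have e0 : ∑ ψ : AddChar V ℂ, ‖∑ y ∈ Y, ψ y‖ ^ 2 = Fintype.card V * (Y.card : ℝ) := by
    have := sum_addChar_normSq_mul_re Y 0
    simpa [Finset.filter_true_of_mem] using this
  have e2 : ∑ ψ : AddChar V ℂ, ‖∑ y ∈ Y, ψ y‖ ^ 2 * ∑ i ∈ s, w i * (ψ (x i)).re ≤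
      ∑ ψ : AddChar V ℂ, ‖∑ y ∈ Y, ψ y‖ ^ 2 * (W / 2 + if ψ = 1 then W / 2 else 0) := by
    refine Finset.sum_le_sum fun ψ _ => mul_le_mul_of_nonneg_left ?_ (by positivity)
    by_cases h : ψ = 1
    · subst h; simp [hW]
    · simpa [h] using hψ ψ h
  have e3 : ∑ ψ : AddChar V ℂ, ‖∑ y ∈ Y, ψ y‖ ^ 2 * (W / 2 + if ψ = 1 then W / 2 else 0) =
      Fintype.card V * (Y.card : ℝ) * (W / 2) + (Y.card : ℝ) ^ 2 * (W / 2) := by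
    simp_rw [mul_add]
    rw [Finset.sum_add_distrib, ← Finset.sum_mul, e0]
    simp
  have hY' : 2 * (Y.card : ℝ) ≤ Fintype.card V := by exact_mod_cast hY
  have e4 : ∑ i ∈ s, w i * ((Y.filter fun y => y + x i ∈ Y).card : ℝ) ≤ 3 / 4 * (W * Y.card) := by
    refine le_of_mul_le_mul_left ?_ hV
    rw [e1]
    refine e2.trans (e3.le.trans ?_)
    nlinarith [mul_le_mul_of_nonneg_left hY' (mul_nonneg hW0 (Nat.cast_nonneg (α := ℝ) Y.card))]
  have e5 : ∑ i ∈ s, w i * ((Y.filter fun y => y + x i ∈ Y).card : ℝ) +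
      ∑ i ∈ s, w i * shiftBoundary Y (x i) = W * Y.card := by
    rw [← Finset.sum_add_distrib, hW, Finset.sum_mul]
    refine Finset.sum_congr rfl fun i _ => ?_
    rw [← card_filter_mem_add_shiftBoundary Y (x i)]
    push_cast; ring
  linarith

end Fourier

/-! ### Spread weights produce an expanding translation -/

section Spread

/-- Parseval: the cross terms vanish because `J ≤ p` keeps the powers `ζ ^ j` distinct. -/
theorem sum_norm_sq_geom_sum_primitiveRoot {p J : ℕ} (hJ : J ≤ p) {ζ : ℂ}
    (hζ : IsPrimitiveRoot ζ p) :
    ∑ c ∈ Finset.range p, ‖∑ j ∈ Finset.range J, (ζ ^ c) ^ j‖ ^ 2 = (p : ℝ) * J := by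
  rcases Nat.eq_zero_or_pos p with rfl | hp
  · simp
  have hnorm : ‖ζ‖ = 1 := hζ.norm'_eq_one hp.ne'
  have hinv : (starRingEnd ℂ) ζ = ζ⁻¹ := (Complex.inv_eq_conj hnorm).symm
  have hζ0 : ζ ≠ 0 := by intro h; simp [h] at hnorm
  have key : ∑ c ∈ Finset.range p, ((‖∑ j ∈ Finset.range J, (ζ ^ c) ^ j‖ ^ 2 : ℝ) : ℂ) =
      (p : ℂ) * J := by
    have h1 : ∀ c, ((‖∑ j ∈ Finset.range J, (ζ ^ c) ^ j‖ ^ 2 : ℝ) : ℂ) =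
        ∑ j ∈ Finset.range J, ∑ k ∈ Finset.range J, (ζ ^ j * (ζ ^ k)⁻¹) ^ c := by
      intro c
      rw [Complex.ofReal_pow, ← Complex.mul_conj', map_sum, Finset.sum_mul_sum]
      refine Finset.sum_congr rfl fun j _ => Finset.sum_congr rfl fun k _ => ?_
      rw [map_pow, map_pow, hinv, mul_pow, inv_pow, inv_pow, inv_pow, ← pow_mul, ← pow_mul,
        ← pow_mul, ← pow_mul, mul_comm c j, mul_comm c k]
    simp_rw [h1]
    rw [Finset.sum_comm]
    have h2 : ∀ j ∈ Finset.range J, ∑ c ∈ Finset.range p, ∑ k ∈ Finset.range J,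
        (ζ ^ j * (ζ ^ k)⁻¹) ^ c = p := by
      intro j hj
      rw [Finset.sum_comm, Finset.sum_eq_single j]
      · simp [hζ0]
      · intro k hk hkj
        have hne : ζ ^ j * (ζ ^ k)⁻¹ ≠ 1 := by
          intro h
          rw [mul_inv_eq_one₀ (pow_ne_zero _ hζ0)] at h
          rw [Finset.mem_range] at hj hk
          exact hkj (hζ.pow_inj (hj.trans_le hJ) (hk.trans_le hJ) h).symm
        have h3 := mul_neg_geom_sum (ζ ^ j * (ζ ^ k)⁻¹) p
        have h4 : (ζ ^ j * (ζ ^ k)⁻¹) ^ p = 1 := by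
          rw [mul_pow, inv_pow, ← pow_mul, ← pow_mul, mul_comm j, mul_comm k, pow_mul, pow_mul,
            hζ.pow_eq_one]
          simp
        rw [h4, sub_self] at h3
        exact (mul_eq_zero.mp h3).resolve_left (sub_ne_zero.mpr (Ne.symm hne))
      · intro h; exact absurd hj h
    rw [Finset.sum_congr rfl h2]
    simp [mul_comm]
  exact_mod_cast key

variable {V : Type*} [AddCommGroup V] [Fintype V] [DecidableEq V]

/-- A weight on an elementary `p`-group with at most `M` on each fibre of each nontrivial
character has an element of positive weight which moves a `1 / (4 J)` proportion of `Y`. -/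
theorem exists_card_le_mul_shiftBoundary {p J : ℕ} (hp : 0 < p) (hV : ∀ v : V, p • v = 0)
    (hJ0 : 0 < J) (hJ : J ≤ p) (w : V → ℝ) (hw : ∀ v, 0 ≤ w v) (M : ℝ)
    (hM : ∀ ψ : AddChar V ℂ, ψ ≠ 1 → ∀ z : ℂ, ∑ v with ψ v = z, w v ≤ M)
    (hMJ : 4 * M * p ≤ (∑ v, w v) * J) (hpos : 0 < ∑ v, w v)
    (Y : Finset V) (hY : 2 * Y.card ≤ Fintype.card V) :
    ∃ v, 0 < w v ∧ Y.card ≤ 4 * J * shiftBoundary Y v := by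
  have hp0 : p ≠ 0 := hp.ne'
  have hζ := Complex.isPrimitiveRoot_exp p hp0
  set ζ := Complex.exp (2 * ↑Real.pi * Complex.I / ↑p)
  have : NeZero p := ⟨hp0⟩
  have hJr : (0 : ℝ) < J := by exact_mod_cast hJ0
  set W := ∑ v, w v with hW
  have hsq : ∀ ψ : AddChar V ℂ, ψ ≠ 1 →
      ∑ v, w v * ‖∑ j ∈ Finset.range J, (ψ v) ^ j‖ ^ 2 ≤ M * (p * J) := by
    intro ψ hψ
    have hmaps : ∀ v ∈ (Finset.univ : Finset V), ψ v ∈ (Finset.range p).image (fun c => ζ ^ c) := by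
      intro v _
      have : ψ v ^ p = 1 := by rw [← AddChar.map_nsmul_eq_pow, hV, AddChar.map_zero_eq_one]
      obtain ⟨i, hi, h⟩ := hζ.eq_pow_of_pow_eq_one this
      exact Finset.mem_image.mpr ⟨i, Finset.mem_range.mpr hi, h⟩
    rw [← Finset.sum_fiberwise_of_maps_to hmaps, Finset.sum_image, ←
      sum_norm_sq_geom_sum_primitiveRoot hJ hζ, Finset.mul_sum]
    · refine Finset.sum_le_sum fun c _ => ?_
      rw [Finset.sum_congr rfl (g := fun v => w v * ‖∑ j ∈ Finset.range J, (ζ ^ c) ^ j‖ ^ 2),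
        ← Finset.sum_mul]
      · exact mul_le_mul_of_nonneg_right (hM ψ hψ _) (by positivity)
      · intro v hv
        rw [(Finset.mem_filter.mp hv).2]
    · intro a ha b hb hab
      exact hζ.pow_inj (Finset.mem_range.mp ha) (Finset.mem_range.mp hb) hab
  have hsumw : ∑ i ∈ (Finset.univ : Finset V) ×ˢ Finset.range J, w i.1 = W * J := by
    rw [Finset.sum_product]; simp [← Finset.sum_mul, mul_comm, hW]
  -- The weight itself may correlate with a character; spreading it over the multiples `j • v`, `j <
  -- J`, replaces `ψ v` by a geometric sum, which is small on average over the fibres.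
  have hmain := le_sum_shiftBoundary_of_re_le ((Finset.univ : Finset V) ×ˢ Finset.range J)
    (fun i => w i.1) (fun i => i.2 • i.1) (fun i _ => hw _) (by
      intro ψ hψ
      rw [hsumw, Finset.sum_product]
      have h1 : ∀ v, ∑ j ∈ Finset.range J, w v * (ψ (j • v)).re ≤
          w v * ‖∑ j ∈ Finset.range J, (ψ v) ^ j‖ ^ 2 / J + w v * (J / 4) := by
        intro v
        rw [← Finset.mul_sum, mul_div_assoc, ← mul_add]
        refine mul_le_mul_of_nonneg_left ?_ (hw v)
        simp_rw [AddChar.map_nsmul_eq_pow]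
        rw [← Complex.re_sum]
        refine (Complex.re_le_norm _).trans ?_
        set D := ‖∑ j ∈ Finset.range J, (ψ v) ^ j‖
        rw [← sub_nonneg]
        have : D ^ 2 / J + J / 4 - D = (D - J / 2) ^ 2 / J := by field_simp; ring
        rw [this]; positivity
      refine (Finset.sum_le_sum fun v _ => h1 v).trans ?_
      rw [Finset.sum_add_distrib, ← Finset.sum_div, ← Finset.sum_mul]
      have h2 : (∑ v, w v * ‖∑ j ∈ Finset.range J, (ψ v) ^ j‖ ^ 2) / J ≤ M * p := by
        rw [div_le_iff₀ hJr]
        linarith [hsq ψ hψ]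
      linarith) Y hY
  rw [hsumw, Finset.sum_product] at hmain
  by_contra! hcon
  -- By subadditivity `j • v` moves at most `J` times as many elements as `v`, so if every `v` fell
  -- short the average would too.
  have hlt : ∑ v, ∑ j ∈ Finset.range J, w v * (shiftBoundary Y (j • v) : ℝ) <
      ∑ v, w v * (J * (Y.card / 4)) := by
    obtain ⟨v0, -, hv0⟩ : ∃ v ∈ (Finset.univ : Finset V), 0 < w v := by
      by_contra! h
      exact absurd hpos (not_lt.mpr (Finset.sum_nonpos h))
    have hstep : ∀ v, 0 < w v → ∑ j ∈ Finset.range J, w v * (shiftBoundary Y (j • v) : ℝ) <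
        w v * (J * (Y.card / 4)) := by
      intro v hv
      rw [← Finset.mul_sum]
      refine mul_lt_mul_of_pos_left ?_ hv
      have hc : (4 * J * shiftBoundary Y v : ℝ) < Y.card := by exact_mod_cast hcon v hv
      calc ∑ j ∈ Finset.range J, (shiftBoundary Y (j • v) : ℝ)
          ≤ ∑ j ∈ Finset.range J, (J * shiftBoundary Y v : ℝ) := by
            refine Finset.sum_le_sum fun j hj => ?_
            have := (shiftBoundary_nsmul_le Y v j).trans
              (Nat.mul_le_mul_right _ (Finset.mem_range.mp hj).le)
            exact_mod_cast this
        _ = J * (J * shiftBoundary Y v) := by simp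
        _ < J * (Y.card / 4) := mul_lt_mul_of_pos_left (by linarith) hJr
    refine Finset.sum_lt_sum (fun v _ => ?_) ⟨v0, Finset.mem_univ _, hstep v0 hv0⟩
    rcases (hw v).eq_or_lt with h | h
    · simp [← h]
    · exact (hstep v h).le
  rw [← Finset.sum_mul, ← hW] at hlt
  linarith

end Spread

theorem Multiset.exists_le_card_eq_of_le_card {α : Type*} {S : Multiset α} {n : ℕ}
    (h : n ≤ S.card) : ∃ T ≤ S, T.card = n := by
  have : (S.powersetCard n).card ≠ 0 := by
    rw [Multiset.card_powersetCard]; exact (Nat.choose_pos h).ne'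
  obtain ⟨T, hT⟩ := Multiset.card_pos_iff_exists_mem.mp (Nat.pos_of_ne_zero this)
  exact ⟨T, Multiset.mem_powersetCard.mp hT⟩

/-! ### Geometric growth of subsums of fixed length -/

section Growth

variable {V : Type*} [AddCommGroup V] [DecidableEq V]

theorem card_add_shiftBoundary_le (Y : Finset V) (a b : V) :
    Y.card + shiftBoundary Y (b - a) ≤ (Y.image (· + a) ∪ Y.image (· + b)).card := by
  have hd : Disjoint (Y.image (· + a)) ((Y.filter fun y => y + (b - a) ∉ Y).image (· + b)) := by
    rw [Finset.disjoint_left]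
    simp only [Finset.mem_image, Finset.mem_filter, not_exists, not_and]
    rintro _ ⟨y, hy, rfl⟩ z ⟨-, hz⟩ h
    apply hz
    have : z + (b - a) = y := by rw [← add_sub_assoc, h]; abel
    rwa [this]
  have hsub : Y.image (· + a) ∪ (Y.filter fun y => y + (b - a) ∉ Y).image (· + b) ⊆
      Y.image (· + a) ∪ Y.image (· + b) :=
    Finset.union_subset_union_right (Finset.image_subset_image (Finset.filter_subset _ _))
  refine le_trans (le_of_eq ?_) (Finset.card_le_card hsub)
  rw [Finset.card_union_of_disjoint hd, Finset.card_image_of_injective _ (add_left_injective a),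
    Finset.card_image_of_injective _ (add_left_injective b), shiftBoundary]

theorem exists_add_eq_of_card_lt_add_card [Fintype V] {Y Z : Finset V}
    (h : Fintype.card V < Y.card + Z.card) (g : V) : ∃ y ∈ Y, ∃ z ∈ Z, y + z = g := by
  by_contra! hcon
  have hd : Disjoint Y (Z.image fun z => g - z) := by
    rw [Finset.disjoint_left]
    intro y hy hy'
    obtain ⟨z, hz, rfl⟩ := Finset.mem_image.mp hy'
    exact hcon _ hy z hz (sub_add_cancel _ _)
  have := Finset.card_le_univ (Y ∪ Z.image fun z => g - z)
  rw [Finset.card_union_of_disjoint hd, Finset.card_image_of_injective _ sub_right_injective] at this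
  omega

open Classical in
-- Each step takes a fresh pair `a, b` and adds exactly one of them to each subsum. A good
-- difference `b - a` enlarges the set of sums by the factor `1 + 1 / (4 * J)`, until it exceeds
-- half of `V`.
theorem exists_large_finset_of_sums [Fintype V] {p J M : ℕ} (hp : 0 < p)
    (hV : ∀ v : V, p • v = 0) (hJ0 : 0 < J) (hJ : J ≤ p) (S : Multiset V)
    (hS : ∀ ψ : AddChar V ℂ, ψ ≠ 1 → ∀ z : ℂ, (S.filter fun v => ψ v = z).card ≤ M) (k : ℕ)
    (hk : 2 * k ≤ S.card) (hk' : 4 * M * p + 2 * k * J ≤ S.card * J) :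
    ∃ B ≤ S, B.card = 2 * k ∧ ∃ Y : Finset V,
      (∀ y ∈ Y, ∃ T ≤ B, T.card = k ∧ T.sum = y) ∧
      (Fintype.card V < 2 * Y.card ∨ (4 * J + 1) ^ k ≤ Y.card * (4 * J) ^ k) := by
  induction k with
  | zero =>
    refine ⟨0, Multiset.zero_le _, rfl, {0}, ?_, ?_⟩
    · intro y hy
      rw [Finset.mem_singleton] at hy
      exact ⟨0, le_rfl, rfl, by simp [hy]⟩
    · simp
  | succ k ih =>
    obtain ⟨B, hB, hBc, Y, hY, hYc⟩ := ih (by omega) (by nlinarith)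
    have hc1 : (S - B).card = S.card - 2 * k := by rw [Multiset.card_sub hB, hBc]
    obtain ⟨a, ha⟩ := Multiset.card_pos_iff_exists_mem.mp (show 0 < (S - B).card by omega)
    -- With `a` fixed, the differences `b - a` inherit the fibre bound, since translation only
    -- permutes the fibres of `ψ`.
    set A := (S - B).erase a with hA
    have hAc : A.card + 1 = S.card - 2 * k := by
      rw [hA, Multiset.card_erase_add_one ha, hc1]
    have hAS : A ≤ S := (Multiset.erase_le _ _).trans (Multiset.sub_le_self _ _)
    have hmain : ∃ b ∈ A, Fintype.card V < 2 * Y.card ∨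
        Y.card ≤ 4 * J * shiftBoundary Y (b - a) := by
      by_cases hlarge : Fintype.card V < 2 * Y.card
      · obtain ⟨b, hb⟩ := Multiset.card_pos_iff_exists_mem.mp (show 0 < A.card by omega)
        exact ⟨b, hb, Or.inl hlarge⟩
      have hsum : ∑ v, (((A.map (· - a)).count v : ℕ) : ℝ) = A.card := by
        rw [← Nat.cast_sum, Multiset.sum_count_eq_card (fun _ _ => Finset.mem_univ _),
          Multiset.card_map]
      obtain ⟨v, hv, hv'⟩ := exists_card_le_mul_shiftBoundary hp hV hJ0 hJ
        (fun v => ((A.map (· - a)).count v : ℝ)) (fun v => Nat.cast_nonneg _) M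
        (by
          intro ψ hψ z
          have h1 : ∑ v with ψ v = z, (A.map (· - a)).count v =
              ((A.map (· - a)).filter fun v => ψ v = z).card := by
            rw [← Multiset.sum_count_eq_card (s := Finset.univ.filter fun v => ψ v = z)
              (fun v hv => by simpa using (Multiset.mem_filter.mp hv).2)]
            refine Finset.sum_congr rfl fun v hv => ?_
            rw [Multiset.count_filter, if_pos (Finset.mem_filter.mp hv).2]
          rw [← Nat.cast_sum, h1, Nat.cast_le, Multiset.filter_map, Multiset.card_map]
          refine le_trans (Multiset.card_le_card ?_) (hS ψ hψ (z * ψ a))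
          refine le_trans (Multiset.monotone_filter_right _ ?_) (Multiset.filter_le_filter _ hAS)
          intro v hv
          simp only [Function.comp] at hv
          rw [← hv, ← AddChar.map_add_eq_mul, sub_add_cancel])
        (by
          rw [hsum]
          have : 4 * M * p ≤ A.card * J := by
            have h2 : A.card + (2 * k + 1) = S.card := by omega
            rw [← h2] at hk'
            nlinarith
          exact_mod_cast this)
        (by rw [hsum]; exact_mod_cast (show 0 < A.card by omega)) Y (by omega)
      have hv1 : v ∈ A.map (· - a) := Multiset.count_pos.mp (by exact_mod_cast hv)
      obtain ⟨b, hb, rfl⟩ := Multiset.mem_map.mp hv1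
      exact ⟨b, hb, Or.inr hv'⟩
    obtain ⟨b, hb, hb'⟩ := hmain
    have hle := card_add_shiftBoundary_le Y a b
    have hBab : B + (a ::ₘ {b}) ≤ S := by
      calc B + (a ::ₘ {b}) ≤ B + (a ::ₘ A) :=
            Multiset.add_le_add_left ((Multiset.cons_le_cons_iff a).mpr
              (Multiset.singleton_le.mpr hb))
        _ = B + (S - B) := by rw [hA, Multiset.cons_erase ha]
        _ = S := by rw [add_comm, Multiset.sub_add_cancel hB]
    refine ⟨B + (a ::ₘ {b}), hBab, by simp [hBc]; ring, Y.image (· + a) ∪ Y.image (· + b), ?_, ?_⟩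
    · intro y hy
      rw [Finset.mem_union, Finset.mem_image, Finset.mem_image] at hy
      rcases hy with ⟨x, hx, rfl⟩ | ⟨x, hx, rfl⟩ <;> obtain ⟨T, hT, hTc, rfl⟩ := hY x hx
      · exact ⟨T + {a}, add_le_add hT (by simp), by simp [hTc], by simp⟩
      · exact ⟨T + {b}, add_le_add hT (by simp), by simp [hTc], by simp⟩
    · by_cases hlarge : Fintype.card V < 2 * Y.card
      · left; omega
      right
      have h1 := hYc.resolve_left hlarge
      have h2 := hb'.resolve_left hlarge
      calc (4 * J + 1) ^ (k + 1) = (4 * J + 1) ^ k * (4 * J + 1) := pow_succ _ _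
        _ ≤ (Y.card * (4 * J) ^ k) * (4 * J + 1) := Nat.mul_le_mul_right _ h1
        _ = (4 * J * Y.card + Y.card) * (4 * J) ^ k := by ring
        _ ≤ (4 * J * (Y.card + shiftBoundary Y (b - a))) * (4 * J) ^ k :=
            Nat.mul_le_mul_right _ (by linarith)
        _ ≤ (4 * J * (Y.image (· + a) ∪ Y.image (· + b)).card) * (4 * J) ^ k :=
            Nat.mul_le_mul_right _ (Nat.mul_le_mul_left _ hle)
        _ = _ := by ring

open Classical in
theorem exists_zero_sum_of_spread [Fintype V] {p J M t : ℕ} (hp : 0 < p)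
    (hV : ∀ v : V, p • v = 0) (hJ0 : 0 < J) (hJ : J ≤ p) (ht : 2 * t ≤ p)
    (htV : Fintype.card V * (4 * J) ^ t ≤ (4 * J + 1) ^ t) (S : Multiset V)
    (hS : ∀ ψ : AddChar V ℂ, ψ ≠ 1 → ∀ z : ℂ, (S.filter fun v => ψ v = z).card ≤ M)
    (hc : 4 * p ≤ S.card) (hc' : 8 * M * p ≤ S.card * J) :
    ∃ T ≤ S, T.card = p ∧ T.sum = 0 := by
  have hbig : ∀ Y : Finset V,
      (Fintype.card V < 2 * Y.card ∨ (4 * J + 1) ^ t ≤ Y.card * (4 * J) ^ t) →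
      Fintype.card V < 2 * Y.card := by
    rintro Y (h | h)
    · exact h
    · have h1 : Fintype.card V ≤ Y.card :=
        Nat.le_of_mul_le_mul_right (htV.trans h) (by positivity)
      have : 0 < Fintype.card V := Fintype.card_pos_iff.mpr ⟨0⟩
      omega
  have hc2 : 4 * M * p + 4 * t * J ≤ S.card * J := by nlinarith
  obtain ⟨B, hB, hBc, Y, hY, hYc⟩ := exists_large_finset_of_sums hp hV hJ0 hJ S hS t
    (by omega) (by nlinarith)
  have hSB : (S - B).card + 2 * t = S.card := by rw [Multiset.card_sub hB]; omega
  obtain ⟨C, hC, hCc, Z, hZ, hZc⟩ := exists_large_finset_of_sums hp hV hJ0 hJ (S - B)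
    (fun ψ hψ z => (Multiset.card_le_card
      (Multiset.filter_le_filter _ (Multiset.sub_le_self _ _))).trans (hS ψ hψ z)) t
    (by omega) (by rw [← hSB] at hc2; nlinarith)
  -- Arbitrary filler brings the length to exactly `p`; two sets above half of `V` have every
  -- element as a sum, including `-R.sum`.
  obtain ⟨R, hR, hRc⟩ := Multiset.exists_le_card_eq_of_le_card
    (S := S - B - C) (n := p - 2 * t) (by rw [Multiset.card_sub hC]; omega)
  obtain ⟨y, hy, z, hz, hyz⟩ := exists_add_eq_of_card_lt_add_card (Y := Y) (Z := Z)
    (by have := hbig Y hYc; have := hbig Z hZc; omega) (-R.sum)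
  obtain ⟨T₁, hT₁, hT₁c, rfl⟩ := hY y hy
  obtain ⟨T₂, hT₂, hT₂c, rfl⟩ := hZ z hz
  refine ⟨T₁ + (T₂ + R), ?_, by simp only [Multiset.card_add]; omega, ?_⟩
  · calc T₁ + (T₂ + R) ≤ B + (C + (S - B - C)) := add_le_add hT₁ (add_le_add hT₂ hR)
      _ = S := by
        rw [add_comm C, Multiset.sub_add_cancel hC, add_comm B, Multiset.sub_add_cancel hB]
  · rw [Multiset.sum_add, Multiset.sum_add, ← add_assoc, hyz, neg_add_cancel]

end Growth

/-- A weak form of the Alon–Dubiner theorem. -/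
theorem exists_zero_sum_of_elementary {p J K t R : ℕ} (hp : p.Prime) (hJ0 : 0 < J) (hJ : J ≤ p)
    (ht : 2 * t ≤ p) (htR : p ^ R * (4 * J) ^ t ≤ (4 * J + 1) ^ t) (hK : 4 ≤ K)
    (hKJ : 8 * p ≤ K * J) (d : ℕ) (hd : d ≤ R) :
    ∀ (V : Type*) [AddCommGroup V] [Finite V], (∀ v : V, p • v = 0) → Nat.card V ≤ p ^ d →
      ∀ S : Multiset V, p * K ^ d ≤ S.card → ∃ T ≤ S, T.card = p ∧ T.sum = 0 := by
  classical
  induction d with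
  | zero =>
    intro V _ _ hV hcard S hS
    have : Subsingleton V := by
      rw [← Finite.card_le_one_iff_subsingleton]; simpa using hcard
    obtain ⟨T, hT, hTc⟩ := Multiset.exists_le_card_eq_of_le_card (S := S) (n := p) (by simpa using hS)
    exact ⟨T, hT, hTc, Subsingleton.elim _ _⟩
  | succ d ih =>
    intro V _ _ hV hcard S hS
    have := Fintype.ofFinite V
    -- Either the sequence is spread, or one fibre holds enough terms to induct in the kernel of
    -- `ψ`.
    by_cases hsp : ∀ ψ : AddChar V ℂ, ψ ≠ 1 → ∀ z : ℂ,
        (S.filter fun v => ψ v = z).card ≤ p * K ^ d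
    · refine exists_zero_sum_of_spread hp.pos hV hJ0 hJ ht ?_ S hsp ?_ ?_
      · rw [← Nat.card_eq_fintype_card]
        exact (Nat.mul_le_mul_right _ (hcard.trans (Nat.pow_le_pow_right hp.pos hd))).trans htR
      · refine le_trans ?_ hS
        have : 1 ≤ K ^ d := Nat.one_le_pow _ _ (by omega)
        rw [pow_succ]; nlinarith [Nat.mul_le_mul this hK, hp.pos]
      · calc 8 * (p * K ^ d) * p = (p * K ^ d) * (8 * p) := by ring
          _ ≤ (p * K ^ d) * (K * J) := Nat.mul_le_mul_left _ hKJ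
          _ = (p * K ^ (d + 1)) * J := by ring
          _ ≤ S.card * J := Nat.mul_le_mul_right _ hS
    · push Not at hsp
      obtain ⟨ψ, hψ, z, hz⟩ := hsp
      set F := S.filter fun v => ψ v = z with hF
      obtain ⟨a, ha⟩ := Multiset.card_pos_iff_exists_mem.mp (lt_of_le_of_lt (Nat.zero_le _) hz)
      let H : AddSubgroup V :=
        { carrier := {v | ψ v = 1}
          zero_mem' := AddChar.map_zero_eq_one ψ
          add_mem' := fun {x y} hx hy => by
            simp only [Set.mem_ofPred_eq] at hx hy ⊢
            rw [AddChar.map_add_eq_mul, hx, hy, one_mul]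
          neg_mem' := fun {x} hx => by
            simp only [Set.mem_ofPred_eq] at hx ⊢
            rw [AddChar.map_neg_eq_conj, hx, map_one] }
      have hHcard : Nat.card H ≤ p ^ d := by
        have h1 : H.index * Nat.card H = Nat.card V := AddSubgroup.index_mul_card H
        have h2 : p ≤ H.index := by
          have hne : H ≠ ⊤ := by
            intro h
            apply hψ
            ext v
            have : v ∈ H := h ▸ AddSubgroup.mem_top v
            rw [AddChar.one_apply]
            exact this
          obtain ⟨v, -, hv⟩ := SetLike.exists_of_lt (lt_top_iff_ne_top.mpr hne)
          have : Fact p.Prime := ⟨hp⟩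
          have hq : addOrderOf (v : V ⧸ H) = p := by
            refine addOrderOf_eq_prime ?_ ?_
            · rw [← QuotientAddGroup.mk_nsmul, hV]; rfl
            · rwa [Ne, QuotientAddGroup.eq_zero_iff]
          rw [AddSubgroup.index, ← hq]
          exact Nat.le_of_dvd Nat.card_pos (addOrderOf_dvd_natCard _)
        refine Nat.le_of_mul_le_mul_left ?_ hp.pos
        calc p * Nat.card H ≤ H.index * Nat.card H := Nat.mul_le_mul_right _ h2
          _ ≤ p ^ (d + 1) := h1 ▸ hcard
          _ = p * p ^ d := by ring
      have hmem : ∀ x ∈ F.map (· - a), x ∈ H := by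
        intro x hx
        obtain ⟨v, hv, rfl⟩ := Multiset.mem_map.mp hx
        have h1 : ψ v = z := (Multiset.mem_filter.mp hv).2
        have h2 : ψ a = z := (Multiset.mem_filter.mp ha).2
        change ψ (v - a) = 1
        rw [AddChar.map_sub_eq_div, h1, h2, div_self]
        rw [← h1]; exact norm_ne_zero_iff.mp (by rw [AddChar.norm_apply]; exact one_ne_zero)
      obtain ⟨U, hU⟩ : ∃ U : Multiset H, U.map Subtype.val = F.map (· - a) :=
        CanLift.prf (F.map (· - a)) hmem
      obtain ⟨T, hT, hTc, hTs⟩ := ih (by omega) H (fun v => Subtype.ext (by simpa using hV v))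
        hHcard U (by
          have := congrArg Multiset.card hU
          simp only [Multiset.card_map] at this
          omega)
      -- Undoing the translation by `a` adds `p • a = 0`, as `T` has exactly `p` terms.
      refine ⟨T.map (fun x : H => (x : V) + a), ?_, by simpa using hTc, ?_⟩
      · have h3 : T.map (fun x : H => (x : V) + a) = (T.map Subtype.val).map (· + a) := by
          rw [Multiset.map_map]; rfl
        rw [h3]
        refine le_trans ?_ (Multiset.filter_le (fun v => ψ v = z) S)
        have h4 := Multiset.map_le_map (f := (· + a)) (Multiset.map_le_map (f := Subtype.val) hT)
        rw [hU, Multiset.map_map] at h4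
        simpa [Function.comp_def] using h4
      · rw [Multiset.sum_map_add, Multiset.map_const', Multiset.sum_replicate, hTc, hV, add_zero]
        have := congrArg Subtype.val hTs
        simpa using this

/-! ### Disjoint blocks with divisible sums -/

theorem Multiset.exists_le_map_eq_of_le_map {α β : Type*} {f : α → β} {S : Multiset α}
    {U : Multiset β} (h : U ≤ S.map f) : ∃ T ≤ S, T.map f = U := by
  induction S using Quotient.inductionOn with
  | h s =>
  induction U using Quotient.inductionOn with
  | h u =>
  obtain ⟨u', hu', hs⟩ : List.Subperm u (s.map f) := h
  obtain ⟨t, ht, rfl⟩ := List.sublist_map_iff.mp hs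
  exact ⟨t, ht.subperm, Quotient.sound hu'⟩

theorem Multiset.join_le_join {α : Type*} {B C : Multiset (Multiset α)} (h : C ≤ B) :
    C.join ≤ B.join := by
  obtain ⟨D, rfl⟩ := Multiset.le_iff_exists_add.mp h
  rw [Multiset.join_add]
  exact Multiset.le_add_right _ _

theorem Multiset.exists_disjoint_blocks {α : Type*} (P : Multiset α → Prop) {m N : ℕ}
    (h : ∀ S : Multiset α, N ≤ S.card → ∃ T ≤ S, T.card = m ∧ P T) (k : ℕ) :
    ∀ S : Multiset α, m * k + N ≤ S.card → ∃ B : Multiset (Multiset α),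
      B.card = k ∧ B.join ≤ S ∧ ∀ T ∈ B, T.card = m ∧ P T := by
  classical
  induction k with
  | zero => exact fun S _ => ⟨0, by simp⟩
  | succ k ih =>
    intro S hS
    rw [Nat.mul_succ] at hS
    obtain ⟨T, hT, hTm, hTP⟩ := h S (by omega)
    obtain ⟨B, hBk, hB, hBP⟩ := ih (S - T) (by rw [Multiset.card_sub hT]; omega)
    refine ⟨T ::ₘ B, by simp [hBk], ?_, ?_⟩
    · rw [Multiset.join_cons]
      calc T + B.join ≤ T + (S - T) := Multiset.add_le_add_left hB
        _ = S := by rw [add_comm, Multiset.sub_add_cancel hT]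
    · intro U hU
      rcases Multiset.mem_cons.mp hU with rfl | hU
      exacts [⟨hTm, hTP⟩, hBP U hU]

section Blocks

variable {ι : Type*}

/-- Any `N` integer vectors contain `m` of them whose sum is divisible by `m`. -/
def HasDivisibleBlocks (ι : Type*) (m N : ℕ) : Prop :=
  ∀ S : Multiset (ι → ℤ), N ≤ S.card → ∃ T ≤ S, T.card = m ∧ ∃ v, T.sum = m • v

theorem HasDivisibleBlocks.mono {m N N' : ℕ} (h : HasDivisibleBlocks ι m N) (hN : N ≤ N') :
    HasDivisibleBlocks ι m N' :=
  fun S hS => h S (hN.trans hS)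

theorem hasDivisibleBlocks_one : HasDivisibleBlocks ι 1 1 := fun S hS => by
  obtain ⟨T, hT, hTc⟩ := Multiset.exists_le_card_eq_of_le_card hS
  exact ⟨T, hT, hTc, T.sum, (one_nsmul _).symm⟩

/-- Extract `Nb` disjoint `a`-blocks, divide their sums by `a`, and select `b` of the quotients. -/
theorem HasDivisibleBlocks.mul {a b Na Nb : ℕ} (ha : HasDivisibleBlocks ι a Na)
    (hb : HasDivisibleBlocks ι b Nb) : HasDivisibleBlocks ι (a * b) (a * Nb + Na) := by
  intro S hS
  obtain ⟨B, hBk, hB, hBP⟩ :=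
    Multiset.exists_disjoint_blocks (fun T => ∃ v, T.sum = a • v) ha Nb S hS
  have hex : ∀ T, ∃ v, T ∈ B → T.sum = a • v := by
    intro T
    by_cases hT : T ∈ B
    · obtain ⟨v, hv⟩ := (hBP T hT).2
      exact ⟨v, fun _ => hv⟩
    · exact ⟨0, fun h => absurd h hT⟩
  choose φ hφ using hex
  obtain ⟨U, hU, hUb, v, hv⟩ := hb (B.map φ) (by simp [hBk])
  obtain ⟨C, hC, rfl⟩ := Multiset.exists_le_map_eq_of_le_map hU
  refine ⟨C.join, ?_, ?_, v, ?_⟩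
  · exact (Multiset.join_le_join hC).trans hB
  · rw [Multiset.card_join, Multiset.map_congr rfl
      (fun T hT => (hBP T (Multiset.mem_of_le hC hT)).1), Multiset.map_const', Multiset.sum_replicate]
    rw [Multiset.card_map] at hUb
    rw [hUb, smul_eq_mul, mul_comm]
  · rw [Multiset.sum_join, Multiset.map_congr rfl
      (fun T hT => hφ T (Multiset.mem_of_le hC hT)), Multiset.sum_map_nsmul, hv, smul_smul]

/-- The bound `m + 2 * X * (m - 1)` survives multiplication by a prime `a` because `a ≥ 2`; it stays
linear in `m` however many prime factors there are. -/
theorem hasDivisibleBlocks_of_primes {X : ℕ} {m : ℕ} (hm : m ≠ 0)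
    (h : ∀ p : ℕ, p.Prime → p ∣ m → HasDivisibleBlocks ι p (p * X)) (N : ℕ)
    (hN : m + 2 * X * m ≤ N + 2 * X) : HasDivisibleBlocks ι m N := by
  induction m using induction_on_primes generalizing N with
  | zero => exact absurd rfl hm
  | one => exact hasDivisibleBlocks_one.mono (by omega)
  | prime_mul a b ha ih =>
    have hb : b ≠ 0 := right_ne_zero_of_mul hm
    obtain ⟨c, rfl⟩ := Nat.exists_eq_succ_of_ne_zero hb
    have h1 := ih hb (fun p hp hpb => h p hp (hpb.mul_left a)) (c + 1 + 2 * X * c)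
      (by rw [Nat.succ_eq_add_one]; ring_nf; omega)
    refine ((h a ha (dvd_mul_right _ _)).mul h1).mono ?_
    rw [Nat.succ_eq_add_one] at hN
    have := ha.two_le
    nlinarith [Nat.mul_le_mul_right X this]

theorem hasDivisibleBlocks_of_zmod {p N : ℕ} [NeZero p]
    (h : ∀ S : Multiset (ι → ZMod p), N ≤ S.card → ∃ T ≤ S, T.card = p ∧ T.sum = 0) :
    HasDivisibleBlocks ι p N := by
  intro S hS
  let f : (ι → ℤ) →+ (ι → ZMod p) := (Int.castAddHom (ZMod p)).compLeft ι
  obtain ⟨U, hU, hUp, hU0⟩ := h (S.map f) (by simpa using hS)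
  obtain ⟨T, hT, rfl⟩ := Multiset.exists_le_map_eq_of_le_map hU
  refine ⟨T, hT, by simpa using hUp, ?_⟩
  rw [← map_multiset_sum] at hU0
  have hdvd : ∀ i, ∃ c, T.sum i = (p : ℤ) * c := fun i => by
    have := congrFun hU0 i
    exact (ZMod.intCast_zmod_eq_zero_iff_dvd _ _).mp this
  choose v hv using hdvd
  exact ⟨v, funext fun i => by simp [hv i]⟩

variable [Fintype ι]

theorem hasDivisibleBlocks_prime_of_pow_card_le {p X : ℕ} (hp : p.Prime)
    (hX : p ^ Fintype.card ι ≤ X) : HasDivisibleBlocks ι p (p * X) := by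
  classical
  have : NeZero p := ⟨hp.ne_zero⟩
  refine hasDivisibleBlocks_of_zmod fun S hS => ?_
  obtain ⟨v, hv⟩ : ∃ v, p ≤ S.count v := by
    by_contra! hcon
    have h1 : S.card ≤ ∑ v : ι → ZMod p, (p - 1) := by
      rw [← Multiset.sum_count_eq_card (s := Finset.univ) (fun a _ => Finset.mem_univ a)]
      exact Finset.sum_le_sum fun v _ => Nat.le_sub_one_of_lt (hcon v)
    rw [Finset.sum_const, Finset.card_univ, Fintype.card_fun, ZMod.card, smul_eq_mul] at h1
    have h2 : p ^ Fintype.card ι * (p - 1) < p ^ Fintype.card ι * p :=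
      Nat.mul_lt_mul_of_pos_left (Nat.sub_lt hp.pos one_pos) (pow_pos hp.pos _)
    nlinarith [Nat.mul_le_mul_left p hX]
  refine ⟨Multiset.replicate p v, Multiset.le_count_iff_replicate_le.mp hv, by simp, ?_⟩
  rw [Multiset.sum_replicate]
  ext i
  simp

theorem hasDivisibleBlocks_prime_of_log_pow_le {p X u : ℕ} (hp : p.Prime)
    (hu : u = 12 * (Fintype.card ι + 1) * (Nat.log 2 p + 1)) (hup : u ≤ p)
    (hX : (16 * u) ^ Fintype.card ι ≤ X) : HasDivisibleBlocks ι p (p * X) := by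
  have : NeZero p := ⟨hp.ne_zero⟩
  set R := Fintype.card ι with hR
  set l := Nat.log 2 p with hl
  have hu0 : 0 < u := by rw [hu]; positivity
  -- As `J ≥ 1`, `p < u * J + u ≤ 2 * u * J`, whence `K = 16 * u` satisfies `8 * p ≤ K * J`.
  set J := p / u with hJ
  have hJ0 : 0 < J := Nat.div_pos hup hu0
  have hJp : u * J ≤ p := Nat.mul_div_le p u
  have hJp' : p < u * J + u := by
    have := Nat.lt_mul_div_succ p hu0
    rwa [mul_add, mul_one] at this
  -- By Bernoulli `4 * J` growth steps double the set, and `R * (l + 1)` doublings exceed `p ^ R`.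
  -- The `12` in `u` makes them fit in `p / 3` steps.
  have hs : 4 * J * (R * (l + 1)) ≤ p / 2 := by
    rw [hu] at hJp
    have h1 : 3 * (4 * J * (R * (l + 1))) ≤ p := by
      refine le_trans ?_ hJp
      have : 12 * (R + 1) * (l + 1) * J =
        3 * (4 * J * (R * (l + 1))) + 12 * (l + 1) * J := by ring
      omega
    have := hp.two_le
    omega
  have hbern : 2 * (4 * J) ^ (4 * J) ≤ (4 * J + 1) ^ (4 * J) := by
    have h4 : (0 : ℝ) < ((4 * J : ℕ) : ℝ) := by exact_mod_cast (by omega : 0 < 4 * J)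
    have h1 := one_add_mul_le_pow (a := 1 / ((4 * J : ℕ) : ℝ))
      (by have : (0 : ℝ) ≤ 1 / ((4 * J : ℕ) : ℝ) := by positivity
          linarith) (4 * J)
    rw [mul_one_div_cancel h4.ne', one_add_div h4.ne', div_pow, le_div_iff₀ (by positivity)] at h1
    have h2 : (2 : ℝ) * ((4 * J : ℕ) : ℝ) ^ (4 * J) ≤ (((4 * J : ℕ) : ℝ) + 1) ^ (4 * J) := by
      linarith
    exact_mod_cast h2
  refine hasDivisibleBlocks_of_zmod fun S hS => ?_
  refine exists_zero_sum_of_elementary (J := J) (K := 16 * u) (t := p / 2) (R := R) hp hJ0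
    (Nat.div_le_self _ _) (Nat.mul_div_le _ _) ?_ (by omega) (by nlinarith) R le_rfl
    (ι → ZMod p) (fun v => by ext i; simp)
    (by rw [Nat.card_fun, Nat.card_zmod, Nat.card_eq_fintype_card]) S (le_trans (Nat.mul_le_mul_left _ hX) hS)
  have hpR : p ^ R ≤ 2 ^ (R * (l + 1)) := by
    rw [mul_comm R, pow_mul]
    exact Nat.pow_le_pow_left (Nat.lt_pow_succ_log_self one_lt_two p).le _
  obtain ⟨e, he⟩ := Nat.exists_eq_add_of_le hs
  rw [he]
  calc p ^ R * (4 * J) ^ (4 * J * (R * (l + 1)) + e)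
      ≤ 2 ^ (R * (l + 1)) * (4 * J) ^ (4 * J * (R * (l + 1)) + e) := Nat.mul_le_mul_right _ hpR
    _ = (2 * (4 * J) ^ (4 * J)) ^ (R * (l + 1)) * (4 * J) ^ e := by
        rw [pow_add _ (4 * J * _), pow_mul _ (4 * J), mul_pow _ _ (R * (l + 1)), mul_assoc]
    _ ≤ ((4 * J + 1) ^ (4 * J)) ^ (R * (l + 1)) * (4 * J + 1) ^ e :=
        Nat.mul_le_mul (Nat.pow_le_pow_left hbern _) (Nat.pow_le_pow_left (Nat.le_succ _) _)
    _ = (4 * J + 1) ^ (4 * J * (R * (l + 1)) + e) := by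
        rw [pow_add, pow_mul _ (4 * J)]

theorem eventually_const_mul_log_pow_le (c : ℕ) (k : ℕ) {ε : ℝ} (hε : 0 < ε) :
    ∀ᶠ n : ℕ in atTop, (((c * (Nat.log 2 n + 1)) ^ k : ℕ) : ℝ) ≤ ε * n := by
  have hc : (0 : ℝ) < (4 * c + 1) ^ k := by positivity
  have h1 := (Real.isLittleO_pow_log_id_atTop (n := k)).def (div_pos hε hc)
  filter_upwards [tendsto_natCast_atTop_atTop.eventually h1, eventually_ge_atTop 2] with n hn hn2
  have hn2' : (2 : ℝ) ≤ n := by exact_mod_cast hn2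
  have hlog2 : (1 / 2 : ℝ) < Real.log 2 := by linarith [Real.log_two_gt_d9]
  have hlogn : Real.log 2 ≤ Real.log n := Real.log_le_log two_pos hn2'
  have hl : (Nat.log 2 n : ℝ) * Real.log 2 ≤ Real.log n := by
    rw [← Real.log_pow]
    refine Real.log_le_log (by positivity) ?_
    exact_mod_cast Nat.pow_log_le_self 2 (by omega)
  have hl3 : (Nat.log 2 n : ℝ) + 1 ≤ 4 * Real.log n := by
    nlinarith [Nat.cast_nonneg (α := ℝ) (Nat.log 2 n)]
  simp only [id, Real.norm_eq_abs] at hn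
  rw [abs_of_nonneg (by linarith : (0 : ℝ) ≤ n)] at hn
  push_cast
  calc ((c : ℝ) * (Nat.log 2 n + 1)) ^ k ≤ ((4 * c + 1) * Real.log n) ^ k := by
        refine pow_le_pow_left₀ (by positivity) ?_ _
        nlinarith [mul_le_mul_of_nonneg_left hl3 (Nat.cast_nonneg (α := ℝ) c)]
    _ = (4 * c + 1) ^ k * Real.log n ^ k := mul_pow _ _ _
    _ ≤ (4 * c + 1) ^ k * (ε / (4 * c + 1) ^ k * n) :=
        mul_le_mul_of_nonneg_left ((le_abs_self _).trans hn) hc.le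
    _ = ε * n := by field_simp

theorem exists_hasDivisibleBlocks_prime (ι : Type*) [Fintype ι] {ε : ℝ} (hε : 0 < ε) :
    ∃ C : ℕ, ∀ p : ℕ, p.Prime → ∀ X : ℕ, ε * p + C ≤ X → HasDivisibleBlocks ι p (p * X) := by
  have h1 := eventually_const_mul_log_pow_le (16 * (12 * (Fintype.card ι + 1))) (Fintype.card ι) hε
  have h2 := eventually_const_mul_log_pow_le (12 * (Fintype.card ι + 1)) 1 one_pos
  obtain ⟨p₀, hp₀⟩ := eventually_atTop.mp (h1.and h2)
  refine ⟨p₀ ^ Fintype.card ι, fun p hp X hX => ?_⟩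
  push_cast at hX
  have hεp : 0 ≤ ε * p := by positivity
  rcases lt_or_ge p p₀ with h | h
  · refine hasDivisibleBlocks_prime_of_pow_card_le hp ?_
    have : p₀ ^ Fintype.card ι ≤ X := by
      have : (p₀ : ℝ) ^ Fintype.card ι ≤ X := by linarith
      exact_mod_cast this
    exact (Nat.pow_le_pow_left h.le _).trans this
  · obtain ⟨ha, hb⟩ := hp₀ p h
    refine hasDivisibleBlocks_prime_of_log_pow_le hp rfl ?_ ?_
    · rw [pow_one, one_mul] at hb
      exact_mod_cast hb
    · rw [← mul_assoc]
      have h0 : (0 : ℝ) ≤ (p₀ : ℝ) ^ Fintype.card ι := by positivity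
      have : (((16 * (12 * (Fintype.card ι + 1)) * (Nat.log 2 p + 1)) ^ Fintype.card ι : ℕ) : ℝ) ≤ X :=
        ha.trans (by linarith)
      exact_mod_cast this

end Blocks

/-! ### Olson's argument in the group algebra -/

section GroupAlgebra

variable {G : Type*} [AddCommGroup G]

theorem exists_zero_sum_of_prod_one_sub_eq_zero {R : Type*} [CommRing R] [Nontrivial R]
    {S : Multiset G}
    (h : (S.map fun x => (1 - AddMonoidAlgebra.single x 1 : AddMonoidAlgebra R G)).prod = 0) :
    ∃ T ≤ S, T ≠ 0 ∧ T.sum = 0 := by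
  classical
  -- Only sums of nonempty subsequences can alter the coefficients of the empty product `1`. All `g`
  -- are treated together because the induction shifts `g` by `-x`.
  have key : ∀ S : Multiset G, ∀ g : G,
      (S.map fun x => (1 - AddMonoidAlgebra.single x 1 : AddMonoidAlgebra R G)).prod.coeff g ≠
        (1 : AddMonoidAlgebra R G).coeff g → ∃ T ≤ S, T ≠ 0 ∧ T.sum = g := by
    intro S
    induction S using Multiset.induction with
    | empty => intro g hg; simp at hg
    | cons x S ih =>
      intro g hg
      set P := (S.map fun x => (1 - AddMonoidAlgebra.single x 1 : AddMonoidAlgebra R G)).prod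
        with hP
      by_cases h1 : P.coeff g = (1 : AddMonoidAlgebra R G).coeff g
      · by_cases h2 : P.coeff (-x + g) = (1 : AddMonoidAlgebra R G).coeff (-x + g)
        · by_cases h3 : -x + g = 0
          · refine ⟨{x}, by simp, by simp, ?_⟩
            rw [Multiset.sum_singleton]
            exact (neg_add_eq_zero.mp h3)
          · exfalso
            apply hg
            rw [Multiset.map_cons, Multiset.prod_cons, ← hP, sub_mul, one_mul,
              AddMonoidAlgebra.coeff_sub, Finsupp.sub_apply, AddMonoidAlgebra.coeff_single_mul_apply,
              h1, h2, AddMonoidAlgebra.one_def, AddMonoidAlgebra.coeff_single,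
              Finsupp.single_eq_of_ne h3]
            simp
        · obtain ⟨T, hT, -, hTs⟩ := ih _ h2
          exact ⟨x ::ₘ T, Multiset.cons_le_cons x hT, Multiset.cons_ne_zero,
            by rw [Multiset.sum_cons, hTs, add_neg_cancel_left]⟩
      · obtain ⟨T, hT, hT0, hTs⟩ := ih _ h1
        exact ⟨T, hT.trans (Multiset.le_cons_self _ _), hT0, hTs⟩
  refine key S 0 ?_
  rw [h, AddMonoidAlgebra.one_def]
  simp

/-- The upper bound in Olson's theorem on the Davenport constant of finite abelian `p`-groups. -/
theorem exists_zero_sum_of_mem_closure {p : ℕ} (hp : p.Prime) {κ : Type*} [Fintype κ] (g : κ → G)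
    (e : κ → ℕ) (he : ∀ i, p ^ e i • g i = 0) (S : Multiset G)
    (hS : ∀ x ∈ S, x ∈ AddSubgroup.closure (Set.range g)) (hc : ∑ i, p ^ e i + 1 ≤ S.card) :
    ∃ T ≤ S, T ≠ 0 ∧ T.sum = 0 := by
  classical
  have : Fact p.Prime := ⟨hp⟩
  have : CharP (AddMonoidAlgebra (ZMod p) G) p :=
    charP_of_injective_algebraMap (algebraMap (ZMod p) (AddMonoidAlgebra (ZMod p) G)).injective p
  let b : G → AddMonoidAlgebra (ZMod p) G := fun x => AddMonoidAlgebra.single x 1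
  have b_add : ∀ x y, b (x + y) = b x * b y := fun x y => by
    simp [b, AddMonoidAlgebra.single_mul_single]
  have b_zero : b 0 = 1 := AddMonoidAlgebra.one_def.symm
  have b_nsmul : ∀ (k : ℕ) x, b (k • x) = b x ^ k := fun k x => by
    induction k with
    | zero => simp [b_zero]
    | succ k ih => rw [succ_nsmul, b_add, ih, pow_succ]
  -- Frobenius gives `(1 - b (g i)) ^ p ^ e i = 0`. The sharp exponent would use `p ^ e i - 1`; the
  -- loss is one per generator.
  have hnil : ∀ s : Finset κ,
      (s.sup fun i => Ideal.span {1 - b (g i)}) ^ (∑ i ∈ s, p ^ e i + 1) = ⊥ := by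
    intro s
    induction s using Finset.induction_on with
    | empty => simp
    | insert i s hi ih =>
      rw [Finset.sup_insert, Finset.sum_insert hi, add_assoc, eq_bot_iff]
      refine (Ideal.sup_pow_add_le_pow_sup_pow).trans ?_
      rw [ih, Ideal.span_singleton_pow, sub_pow_char_pow, one_pow, ← b_nsmul, he, b_zero, sub_self]
      simp
  set I := (Finset.univ : Finset κ).sup fun i => Ideal.span {1 - b (g i)} with hI
  have hgI : ∀ i, 1 - b (g i) ∈ I := fun i =>
    (Finset.le_sup (f := fun i => Ideal.span {1 - b (g i)}) (Finset.mem_univ i))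
      (Ideal.mem_span_singleton_self _)
  have hmem : ∀ x ∈ AddSubgroup.closure (Set.range g), 1 - b x ∈ I := by
    intro x hx
    induction hx using AddSubgroup.closure_induction with
    | mem x hx => obtain ⟨i, rfl⟩ := hx; exact hgI i
    | zero => simp [b_zero]
    | add x y _ _ hx hy =>
      have : 1 - b (x + y) = (1 - b x) + b x * (1 - b y) := by rw [b_add]; ring
      rw [this]
      exact I.add_mem hx (I.mul_mem_left _ hy)
    | neg x _ hx =>
      have h1 : b (-x) * b x = 1 := by rw [← b_add, neg_add_cancel, b_zero]
      have : 1 - b (-x) = -b (-x) * (1 - b x) := by linear_combination -h1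
      rw [this]
      exact I.mul_mem_left _ hx
  have hprod : ∀ S : Multiset G, (∀ x ∈ S, 1 - b x ∈ I) →
      (S.map fun x => 1 - b x).prod ∈ I ^ S.card := by
    intro S
    induction S using Multiset.induction with
    | empty => simp
    | cons x S ih =>
      intro h
      rw [Multiset.map_cons, Multiset.prod_cons, Multiset.card_cons, pow_succ']
      exact Ideal.mul_mem_mul (h x (Multiset.mem_cons_self _ _))
        (ih fun y hy => h y (Multiset.mem_cons_of_mem hy))
  refine exists_zero_sum_of_prod_one_sub_eq_zero (R := ZMod p) ?_
  have := Ideal.pow_le_pow_right hc (hprod S fun x hx => hmem x (hS x hx))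
  rwa [hI, hnil, Ideal.mem_bot] at this

end GroupAlgebra

/-! ### Bounds for the Davenport constant -/

section Davenport

variable {L : Type*} [AddCommGroup L]

theorem davenport_le_of_forall {G : Type*} [AddCommGroup G] {t : ℕ} (ht : 1 ≤ t)
    (h : ∀ S : Multiset G, t ≤ S.card → ∃ T ≤ S, T ≠ 0 ∧ T.sum = 0) : davenport G ≤ t :=
  Nat.sInf_le ⟨ht, h⟩

/-- An empty infimum in `ℕ` is `0`, so an admissible `t` is needed for the infimum to be attained.
-/
theorem exists_zero_sum_of_davenport_le {G : Type*} [AddCommGroup G] {t : ℕ} (ht : 1 ≤ t)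
    (h : ∀ S : Multiset G, t ≤ S.card → ∃ T ≤ S, T ≠ 0 ∧ T.sum = 0) (S : Multiset G)
    (hS : davenport G ≤ S.card) : ∃ T ≤ S, T ≠ 0 ∧ T.sum = 0 :=
  (Nat.sInf_mem (s := {t : ℕ | 1 ≤ t ∧
    ∀ S : Multiset G, t ≤ S.card → ∃ T ≤ S, T ≠ 0 ∧ T.sum = 0}) ⟨t, ht, h⟩).2 S hS

/-- The standard generators of `L × (ZMod n) ^ r`. -/
def prodGenerator (L : Type*) [AddCommGroup L] (r n : ℕ) : L ⊕ Fin r → L × (Fin r → ZMod n) :=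
  Sum.elim (fun l => (l, 0)) fun i => (0, Pi.single i 1)

theorem exists_eq_sum_zsmul_prodGenerator [Fintype L] {r n : ℕ} (x : L × (Fin r → ZMod n)) :
    ∃ v : L ⊕ Fin r → ℤ, ∑ i, v i • prodGenerator L r n i = x := by
  classical
  choose c hc using fun i => ZMod.intCast_surjective (x.2 i)
  refine ⟨Sum.elim (Pi.single x.1 1) c, ?_⟩
  rw [Fintype.sum_sum_type]
  ext j
  · simp [prodGenerator, Prod.fst_sum, Pi.single_apply]
  · simp [prodGenerator, Prod.snd_sum, Finset.sum_apply, Pi.single_apply, hc]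

theorem exists_zero_sum_of_hasDivisibleBlocks [Fintype L] {r n m p k N : ℕ} (hp : p.Prime)
    (hm : 0 < m) (hn : n = m * p ^ k) (hL : AddMonoid.exponent L ∣ n)
    (hN : HasDivisibleBlocks (L ⊕ Fin r) m N) (S : Multiset (L × (Fin r → ZMod n)))
    (hS : m * (Fintype.card L * Fintype.card L + r * p ^ k + 1) + N ≤ S.card) :
    ∃ T ≤ S, T ≠ 0 ∧ T.sum = 0 := by
  classical
  set g := prodGenerator L r n with hg
  let π : (L ⊕ Fin r → ℤ) →+ L × (Fin r → ZMod n) :=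
    { toFun := fun v => ∑ i, v i • g i
      map_zero' := by simp
      map_add' := fun v w => by simp [add_smul, Finset.sum_add_distrib] }
  choose σ hσ using fun x => exists_eq_sum_zsmul_prodGenerator (L := L) (r := r) (n := n) x
  have hπσ : ∀ x, π (σ x) = x := hσ
  obtain ⟨B, hBk, hB, hBP⟩ := Multiset.exists_disjoint_blocks
    (fun T : Multiset (L × (Fin r → ZMod n)) => ∃ v, T.sum = m • π v) (m := m) (N := N) (by
      intro S hS
      obtain ⟨U, hU, hUm, v, hv⟩ := hN (S.map σ) (by simpa using hS)
      obtain ⟨T, hT, rfl⟩ := Multiset.exists_le_map_eq_of_le_map hU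
      refine ⟨T, hT, by simpa using hUm, v, ?_⟩
      rw [← map_nsmul, ← hv, map_multiset_sum, Multiset.map_map]
      simp [hπσ]) _ S hS
  -- Bounding these orders by `|L|` rather than `p ^ k` makes the cost of `L` at most `|L| ^ 2`
  -- blocks, independently of `n`.
  have hexp : ∀ l : L, ∃ e, p ^ e • (m • l) = 0 ∧ p ^ e ≤ Fintype.card L := by
    intro l
    have h1 : addOrderOf (m • l) ∣ p ^ k := by
      rw [addOrderOf_dvd_iff_nsmul_eq_zero, smul_smul, mul_comm, ← hn]
      obtain ⟨c, hc⟩ := hL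
      rw [hc, mul_comm, mul_smul, AddMonoid.exponent_nsmul_eq_zero, smul_zero]
    obtain ⟨e, -, he⟩ := (Nat.dvd_prime_pow hp).mp h1
    refine ⟨e, by rw [← he, addOrderOf_nsmul_eq_zero], ?_⟩
    rw [← he]
    exact addOrderOf_le_card_univ
  choose e he heL using hexp
  obtain ⟨U, hU, hU0, hUs⟩ := exists_zero_sum_of_mem_closure hp (fun i => m • g i)
    (Sum.elim e fun _ => k) (by
      rintro (l | i)
      · ext j
        · simp [hg, prodGenerator, he]
        · simp [hg, prodGenerator]
      · rw [Sum.elim_inr, smul_smul, mul_comm, ← hn]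
        ext j
        · simp [hg, prodGenerator]
        · simp [hg, prodGenerator])
    (B.map Multiset.sum) (by
      intro x hx
      obtain ⟨T, hT, rfl⟩ := Multiset.mem_map.mp hx
      obtain ⟨v, hv⟩ := (hBP T hT).2
      rw [hv]
      change m • ∑ i, v i • g i ∈ _
      rw [Finset.smul_sum]
      refine AddSubgroup.sum_mem _ fun i _ => ?_
      rw [smul_comm]
      exact AddSubgroup.zsmul_mem _ (AddSubgroup.subset_closure (Set.mem_range_self i)) _)
    (by
      rw [Multiset.card_map, hBk, Fintype.sum_sum_type]
      simp only [Sum.elim_inl, Sum.elim_inr, Finset.sum_const, Finset.card_univ, Fintype.card_fin,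
        smul_eq_mul]
      have : ∑ l, p ^ e l ≤ Fintype.card L * Fintype.card L := by
        simpa using Finset.sum_le_card_nsmul Finset.univ (fun l => p ^ e l) _ fun l _ => heL l
      omega)
  obtain ⟨C, hC, rfl⟩ := Multiset.exists_le_map_eq_of_le_map hU
  refine ⟨C.join, (Multiset.join_le_join hC).trans hB, ?_, ?_⟩
  · intro h0
    obtain ⟨T, hT⟩ := Multiset.exists_mem_of_ne_zero (s := C) (by rintro rfl; simp at hU0)
    have hTm := (hBP T (Multiset.mem_of_le hC hT)).1
    have hT0 : T ≤ C.join := by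
      have := Multiset.join_le_join (Multiset.singleton_le.mpr hT)
      simpa using this
    rw [h0, nonpos_iff_eq_zero] at hT0
    rw [hT0] at hTm
    simp at hTm
    omega
  · rw [Multiset.sum_join, hUs]

/-- In `n - 1` copies of each basis vector, a zero sum would force a positive multiplicity below `n`
to be divisible by `n`. -/
theorem mul_lt_of_forall_exists_zero_sum {r n t : ℕ} (hn : 2 ≤ n)
    (h : ∀ S : Multiset (L × (Fin r → ZMod n)), t ≤ S.card → ∃ T ≤ S, T ≠ 0 ∧ T.sum = 0) :
    r * (n - 1) < t := by
  classical
  by_contra! hcon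
  have : Fact (1 < n) := ⟨hn⟩
  let a : Fin r → L × (Fin r → ZMod n) := fun i => (0, Pi.single i 1)
  have ha : Function.Injective a := by
    intro i j hij
    by_contra hne
    have := congrFun (congrArg Prod.snd hij) i
    simp [a, hne] at this
  obtain ⟨T, hT, hT0, hTs⟩ := h (∑ i, Multiset.replicate (n - 1) (a i)) (by simpa using hcon)
  have hmem : ∀ x ∈ T, ∃ i, x = a i := by
    intro x hx
    obtain ⟨i, -, hi⟩ := Multiset.mem_sum.mp (Multiset.mem_of_le hT hx)
    exact ⟨i, Multiset.eq_of_mem_replicate hi⟩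
  have hcount : ∀ i, T.count (a i) ≤ n - 1 := by
    intro i
    refine (Multiset.count_le_of_le _ hT).trans ?_
    rw [Multiset.count_sum', Finset.sum_eq_single i]
    · simp
    · intro j _ hj
      exact Multiset.count_eq_zero.mpr fun h => hj (ha (Multiset.eq_of_mem_replicate h)).symm
    · simp
  have hcoord : ∀ i, ∀ T : Multiset (L × (Fin r → ZMod n)), (∀ x ∈ T, ∃ i, x = a i) →
      T.sum.2 i = (T.count (a i) : ZMod n) := by
    intro i T
    induction T using Multiset.induction with
    | empty => simp
    | cons x T ih =>
      intro hT
      obtain ⟨j, rfl⟩ := hT x (Multiset.mem_cons_self _ _)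
      rw [Multiset.sum_cons, Prod.snd_add, Pi.add_apply,
        ih fun y hy => hT y (Multiset.mem_cons_of_mem hy), Multiset.count_cons, Nat.cast_add,
        add_comm]
      congr 1
      by_cases hij : i = j
      · subst hij; simp [a]
      · have : a i ≠ a j := fun h => hij (ha h)
        simp [a, hij]
        simpa [a] using this
  obtain ⟨x, hx⟩ := Multiset.exists_mem_of_ne_zero hT0
  obtain ⟨i, rfl⟩ := hmem x hx
  have h1 := hcoord i T hmem
  rw [hTs, Prod.snd_zero, Pi.zero_apply, eq_comm, ZMod.natCast_eq_zero_iff] at h1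
  have h2 := Multiset.count_pos.mpr hx
  have := Nat.le_of_dvd h2 h1
  have := hcount i
  omega

/-- If all maximal prime powers in `n` were below `Q`, so would be its primes, and `n ≤ Q ^ Q`. -/
theorem exists_large_prime_pow_dvd (Q n : ℕ) (hQ : Q ^ Q < n) (hn : 2 ≤ n) :
    ∃ p k, p.Prime ∧ p ^ k ∣ n ∧ Q ≤ p ^ k ∧ ∀ q : ℕ, q.Prime → q ∣ n → q ≤ p ^ k := by
  have hn0 : n ≠ 0 := by omega
  obtain ⟨p, hp, hmax⟩ := Finset.exists_max_image n.primeFactors (fun p => p ^ n.factorization p)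
    (Nat.nonempty_primeFactors.mpr (by omega))
  have hself : ∀ q : ℕ, q.Prime → q ∣ n → q ≤ q ^ n.factorization q := fun q hq hqn =>
    Nat.le_self_pow (hq.factorization_pos_of_dvd hn0 hqn).ne' q
  refine ⟨p, n.factorization p, Nat.prime_of_mem_primeFactors hp, Nat.ordProj_dvd n p, ?_,
    fun q hq hqn => (hself q hq hqn).trans (hmax q (Nat.mem_primeFactors.mpr ⟨hq, hqn, hn0⟩))⟩
  by_contra! hlt
  have h1 : n.primeFactors ⊆ Finset.range Q := fun q hq => Finset.mem_range.mpr
    (((hself q (Nat.prime_of_mem_primeFactors hq) (Nat.dvd_of_mem_primeFactors hq)).trans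
      (hmax q hq)).trans_lt hlt)
  have hQ0 : 0 < Q := by omega
  have h2 : n ≤ Q ^ Q := by
    calc n = ∏ q ∈ n.primeFactors, q ^ n.factorization q :=
          (Nat.prod_factorization_pow_eq_self hn0).symm
      _ ≤ ∏ q ∈ n.primeFactors, Q := Finset.prod_le_prod' fun q hq => (hmax q hq).trans hlt.le
      _ = Q ^ n.primeFactors.card := Finset.prod_const _
      _ ≤ Q ^ Q := Nat.pow_le_pow_right hQ0 (by simpa using Finset.card_le_card h1)
  omega

theorem exists_davenport_bound [Fintype L] (r : ℕ) {ε : ℝ} (hε : 0 < ε) :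
    ∃ n₀ : ℕ, ∀ n, n₀ ≤ n → AddMonoid.exponent L ∣ n → ∃ t : ℕ, (t : ℝ) ≤ (r + ε) * n ∧ 1 ≤ t ∧
      ∀ S : Multiset (L × (Fin r → ZMod n)), t ≤ S.card → ∃ T ≤ S, T ≠ 0 ∧ T.sum = 0 := by
  obtain ⟨C, hC⟩ := exists_hasDivisibleBlocks_prime (L ⊕ Fin r) (show 0 < ε / 4 by positivity)
  -- `A` gathers the terms per unit of `m` that do not grow with `q`; the rest is `r * q` and `ε / 2
  -- * q` from `2 * X`. Taking `q ≥ 2 * A / ε` pays for `A` with the other `ε / 2 * q`.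
  set A := Fintype.card L * Fintype.card L + 2 * C + 4 with hA
  obtain ⟨Q, hQ⟩ := exists_nat_ge (2 * A / ε)
  refine ⟨Q ^ Q + 2, fun n hn hL => ?_⟩
  obtain ⟨p, k, hp, ⟨m, hm⟩, hQk, hmax⟩ := exists_large_prime_pow_dvd Q n (by omega) (by omega)
  have hm0 : 0 < m := Nat.pos_of_ne_zero (by rintro rfl; omega)
  set q := p ^ k with hq
  set X := ⌈ε / 4 * q + C⌉₊ with hX
  have hX1 : ε / 4 * q + C ≤ X := Nat.le_ceil _
  have hX2 : (X : ℝ) < ε / 4 * q + C + 1 := Nat.ceil_lt_add_one (by positivity)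
  have hblocks : HasDivisibleBlocks (L ⊕ Fin r) m (m + 2 * X * m) :=
    hasDivisibleBlocks_of_primes (X := X) hm0.ne' (fun s hs hsm => hC s hs X (by
      have : (s : ℝ) ≤ q := by exact_mod_cast hmax s hs (hm ▸ hsm.mul_left q)
      nlinarith)) _ (by omega)
  refine ⟨m * (Fintype.card L * Fintype.card L + r * q + 1) + (m + 2 * X * m), ?_, by nlinarith,
    fun S hS => exists_zero_sum_of_hasDivisibleBlocks hp hm0 (by rw [hm, mul_comm]) hL hblocks S hS⟩
  have hmr : (0 : ℝ) < m := by exact_mod_cast hm0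
  have hnr : (n : ℝ) = q * m := by exact_mod_cast hm
  have hAr : (A : ℝ) = Fintype.card L * Fintype.card L + 2 * C + 4 := by rw [hA]; push_cast; ring
  have hAq : (A : ℝ) ≤ ε / 2 * q := by
    have h1 : (2 * A / ε : ℝ) ≤ q := hQ.trans (by exact_mod_cast hQk)
    rw [div_le_iff₀ hε] at h1
    linarith
  push_cast
  rw [hnr]
  nlinarith [mul_le_mul_of_nonneg_left hX2.le hmr.le, mul_le_mul_of_nonneg_left hAq hmr.le]

end Davenport

theorem theorem5 {L : Type*} [AddCommGroup L] [Finite L] (r : ℕ) (hr : 1 ≤ r) :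
    (fun n : ℕ => (davenport (L × (Fin r → ZMod n)) : ℝ))
      ~[atTop ⊓ 𝓟 {n : ℕ | AddMonoid.exponent L ∣ n}] (fun n : ℕ => (r : ℝ) * (n : ℝ)) := by
  have := Fintype.ofFinite L
  refine Asymptotics.isLittleO_iff.mpr fun ε hε => ?_
  obtain ⟨n₀, hn₀⟩ := exists_davenport_bound (L := L) r hε
  obtain ⟨n₁, hn₁⟩ := exists_nat_ge (1 / ε)
  rw [eventually_inf_principal]
  filter_upwards [eventually_ge_atTop (n₀ + n₁ + 2)] with n hn hL
  obtain ⟨t, ht, ht1, htS⟩ := hn₀ n (by omega) hL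
  have hupper := davenport_le_of_forall ht1 htS
  have hlower : r * (n - 1) < davenport (L × (Fin r → ZMod n)) :=
    mul_lt_of_forall_exists_zero_sum (by omega) (exists_zero_sum_of_davenport_le ht1 htS)
  obtain ⟨s, rfl⟩ : ∃ s, n = s + 1 := ⟨n - 1, by omega⟩
  set D := davenport (L × (Fin r → ZMod (s + 1)))
  have hupper' : (D : ℝ) ≤ t := by exact_mod_cast hupper
  have hlower' : (r * s : ℝ) < D := by exact_mod_cast hlower
  have hrr : (1 : ℝ) ≤ r := by exact_mod_cast hr
  -- The lower bound falls short of `r * n` by less than `r`, which is at most `ε * r * n` once `n ≥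
  -- 1 / ε`.
  have hεn : 1 ≤ ε * ((s + 1 : ℕ) : ℝ) := by
    have h1 : 1 / ε ≤ ((s + 1 : ℕ) : ℝ) := hn₁.trans (by exact_mod_cast (by omega : n₁ ≤ s + 1))
    rw [div_le_iff₀ hε] at h1
    linarith
  simp only [Pi.sub_apply, Real.norm_eq_abs]
  rw [abs_of_nonneg (by positivity : (0 : ℝ) ≤ r * ((s + 1 : ℕ) : ℝ)), abs_le]
  push_cast at *
  constructor <;> nlinarith
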